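/- **Setting.** A *GP 2 host graph* is a finite directed graph, possibly with parallel edges and loops, whose nodes and edges are labelled with lists of integers and character strings; every node is unmarked, red, green, blue or grey, every edge is unmarked, red, green, blue or dashed, and some nodes are *roots*. Its *size* is the total number of its nodes and edges; the *degree* of a node is the number of its outgoing plus the number of its incoming edges. An *input graph* is an arbitrarily labelled host graph in which every node is grey and unrooted and every edge is unmarked. The program *is-connected* is $$\texttt{Main = try init then (DFS!; Check)},\quad \texttt{DFS = forward!; try back else break},\quad \texttt{Check = if match then fail},$$ with the following rules, none of which changes the underlying graph or the labels. $\texttt{init}$: an unrooted grey node becomes a blue root. $\texttt{match}$: matches an unrooted grey node and changes nothing. $\texttt{forward}$: for a blue root $u$ that is joined by an unmarked edge (of either direction) to an unrooted grey node $v$, the node $u$ becomes an unrooted blue node, $v$ a blue root, and the edge dashed. $\texttt{back}$: for a blue root $v$ that is joined by a dashed edge (of either direction) to an unrooted blue node $u$, the node $u$ becomes a blue root, $v$ an unrooted unmarked node, and the edge unmarked. A rule is applied at any injective match that preserves marks and preserves and reflects rootedness; a call of a rule fails if there is no match. Commands are executed according to the small-step operational semantics of GP 2, a relation on configurations (a command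 sequence with a host graph, or a host graph, or fail), and executions are non-deterministic. A program *terminates* on $G$ if it cannot diverge (also not inside the condition of a conditional or inside a loop body) and cannot get stuck, so that every execution ends with a graph or with fail. **Running time.** The implementation stores a host graph by linked lists of its nodes, of its roots, and of the outgoing and of the incoming edges of every node, in arbitrary order. A match of a rule is searched by backtracking along a search plan: an edge with an already matched endpoint is matched next by running through the list of edges at that endpoint; if there is no such edge, an unmatched root of the rule is matched by running through the list of roots; if there is none either, an unmatched node by running through the list of nodes. Fetching the first or next element of a list, testing, setting or clearing the flag that tells whether an item is matched, and comparing the attributes of an item with those required by the rule are basic operations of unit time. A successful call takes, in addition to its search, a constant time per item of the rule for rewriting; $\texttt{break}$, $\texttt{fail}$ and every other transfer of control take unit time. The running time of an execution on $G$ is the sum of all these times, plus $\mathrm{size}(G)$ for loading $G$ and $\mathrm{size}(G)$ for writing the output. For a rule $r$, let $s_r(N)$ be an upper bound on the number of calls of $r$ (successful or not) in an execution, and $t_r(N)$ an upper bound on the number of basic operations of one call of $r$ (which include the inspection of every candidate for a match), over all executions on the input graphs of size $N$ in the class considered; let $K(N)=\sum_r s_r(N)\,t_r(N)$, where $r$ ranges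 over the four rules. **Theorem (Complexity of is-connected).** On every class of input graphs of bounded node degree, is-connected terminates in time linear in the size of its input. That is, for every $d\in\mathbb N$ there is a constant $c$, depending only on $d$, such that: 1. on every input graph $G$ whose nodes all have degree at most $d$, the program is-connected terminates, and every execution, whatever choices are made, has running time at most $c\,(\mathrm{size}(G)+1)$; 2. for the class of input graphs whose nodes all have degree at most $d$, there are upper bounds $s_r,t_r$ as above with $K(N)\le c\,(N+1)$ for all $N\in\mathbb N$. -/

import Mathlib

open scoped BigOperators

namespace GP2

/-! ### Host graphs -/

/-- Labels are lists of integers and character strings. -/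
inductive Atom where
  | int (z : ℤ)
  | str (s : String)

/-- The marks a node of a host graph can carry. -/
inductive NodeMark where
  | unmarked | red | green | blue | grey
  deriving DecidableEq

/-- The marks an edge of a host graph can carry. -/
inductive EdgeMark where
  | unmarked | red | green | blue | dashed
  deriving DecidableEq

/-- A host graph with node set `V` and edge set `E`: a directed graph, possibly with parallel edges
and loops, whose nodes and edges are labelled and marked, and some of whose nodes are roots. -/
@[ext] structure HostGraph (V E : Type) where
  src : E → V
  tgt : E → V
  nodeLabel : V → List Atom
  nodeMark : V → NodeMark
  isRoot : V → Bool
  edgeLabel : E → List Atom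
  edgeMark : E → EdgeMark

namespace HostGraph

variable {V E : Type}

/-- The size of a graph: the total number of its nodes and edges. -/
noncomputable def size (_G : HostGraph V E) : ℕ := Nat.card V + Nat.card E

/-- The degree of a node: number of outgoing plus number of incoming edges (a loop counts twice). -/
noncomputable def degree (G : HostGraph V E) (v : V) : ℕ :=
  Nat.card {e : E // G.src e = v} + Nat.card {e : E // G.tgt e = v}

/-- Input graphs: arbitrarily labelled, all nodes grey and unrooted, all edges unmarked. -/
structure IsInput (G : HostGraph V E) : Prop where
  grey : ∀ v, G.nodeMark v = NodeMark.grey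
  unrooted : ∀ v, G.isRoot v = false
  unmarked : ∀ e, G.edgeMark e = EdgeMark.unmarked

end HostGraph

/-! ### Rules and their application -/

/-- A (relabelling) rule `L ⇒ R`: all items of `L` are kept, so `L` and `R` have the same underlying
graph, with nodes `Fin n` and edges `Fin m`; they differ in labels, marks and roots.
The label of every item of `L` is a list variable, and different items carry different variables,
so that a variable is named by the item of `L` that carries it: `Sum.inl i` is the variable of node
`i`, and `Sum.inr e` the one of edge `e`. The label of an item of `R` is one of these variables.
An edge with `bidir e = true` is drawn without arrow head and matches host edges of either
direction. -/
structure Rule where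
  n : ℕ
  m : ℕ
  src : Fin m → Fin n
  tgt : Fin m → Fin n
  bidir : Fin m → Bool
  lhsNodeMark : Fin n → NodeMark
  lhsRoot : Fin n → Bool
  lhsEdgeMark : Fin m → EdgeMark
  rhsNodeLabel : Fin n → Fin n ⊕ Fin m
  rhsNodeMark : Fin n → NodeMark
  rhsRoot : Fin n → Bool
  rhsEdgeLabel : Fin m → Fin n ⊕ Fin m
  rhsEdgeMark : Fin m → EdgeMark

variable {V E : Type}

/-- A match of (an instance of) the left-hand graph of `r` in `G`: an injective graph morphism that
preserves marks and both preserves and reflects rootedness. -/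
structure Match (r : Rule) (G : HostGraph V E) where
  node : Fin r.n → V
  edge : Fin r.m → E
  node_injective : Function.Injective node
  edge_injective : Function.Injective edge
  ends : ∀ e, (G.src (edge e) = node (r.src e) ∧ G.tgt (edge e) = node (r.tgt e)) ∨
    (r.bidir e = true ∧ G.src (edge e) = node (r.tgt e) ∧ G.tgt (edge e) = node (r.src e))
  nodeMark : ∀ i, G.nodeMark (node i) = r.lhsNodeMark i
  isRoot : ∀ i, G.isRoot (node i) = r.lhsRoot i
  edgeMark : ∀ e, G.edgeMark (edge e) = r.lhsEdgeMark e

/-- The value that a match assigns to a list variable. -/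
def Match.value {r : Rule} {G : HostGraph V E} (g : Match r G) : Fin r.n ⊕ Fin r.m → List Atom
  | Sum.inl i => G.nodeLabel (g.node i)
  | Sum.inr e => G.edgeLabel (g.edge e)

/-- The result of applying the rule `r` to `G` at the match `g`: labels, marks and roots of the
matched items are replaced by those of the instantiated right-hand side. -/
noncomputable def Match.result {r : Rule} {G : HostGraph V E} (g : Match r G) : HostGraph V E where
  src := G.src
  tgt := G.tgt
  nodeLabel := Function.extend g.node (fun i => g.value (r.rhsNodeLabel i)) G.nodeLabel
  nodeMark := Function.extend g.node r.rhsNodeMark G.nodeMark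
  isRoot := Function.extend g.node r.rhsRoot G.isRoot
  edgeLabel := Function.extend g.edge (fun e => g.value (r.rhsEdgeLabel e)) G.edgeLabel
  edgeMark := Function.extend g.edge r.rhsEdgeMark G.edgeMark

/-! ### The matching algorithm, with its number of basic operations

A match is searched by backtracking along a search plan. The basic operations are: fetching the
first or next node, root, incoming edge or outgoing edge in the respective linked list; testing
whether an item is already matched; setting or clearing the flag of an item that says so; comparing
the attributes (mark, rootedness, endpoints) of an item with those that the rule asks for. Each
counts one. -/

/-- The linked lists by which a host graph is stored. Their order is arbitrary. -/
structure Layout (G : HostGraph V E) where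
  nodes : List V
  roots : List V
  outEdges : V → List E
  inEdges : V → List E
  nodes_nodup : nodes.Nodup
  mem_nodes : ∀ v, v ∈ nodes
  roots_nodup : roots.Nodup
  mem_roots : ∀ v, v ∈ roots ↔ G.isRoot v = true
  outEdges_nodup : ∀ v, (outEdges v).Nodup
  mem_outEdges : ∀ v e, e ∈ outEdges v ↔ G.src e = v
  inEdges_nodup : ∀ v, (inEdges v).Nodup
  mem_inEdges : ∀ v e, e ∈ inEdges v ↔ G.tgt e = v

/-- Operations of a search plan: match a root of the rule by running through the root list, match
a node by running through the node list, or match an edge one of whose endpoints is matched already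
by running through the edges at that endpoint (and match the other endpoint along with it). -/
inductive PlanOp (n m : ℕ) where
  | root (i : Fin n)
  | node (i : Fin n)
  | edge (e : Fin m)

/-- The next operation of the search plan once the nodes `ns` and the edges `es` are matched: an
edge at a matched node if there is one, else a root, else any other node. -/
def Rule.nextOp (r : Rule) (ns : List (Fin r.n)) (es : List (Fin r.m)) : Option (PlanOp r.n r.m) :=
  match (List.finRange r.m).find?
      (fun e => decide (e ∉ es ∧ (r.src e ∈ ns ∨ r.tgt e ∈ ns))) with
  | some e => some (PlanOp.edge e)
  | none =>
    match (List.finRange r.n).find? (fun i => decide (i ∉ ns ∧ r.lhsRoot i = true)) with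
    | some i => some (PlanOp.root i)
    | none => ((List.finRange r.n).find? (fun i => decide (i ∉ ns))).map PlanOp.node

/-- The first `k` operations of the rest of the search plan. -/
def Rule.planFrom (r : Rule) : ℕ → List (Fin r.n) → List (Fin r.m) → List (PlanOp r.n r.m)
  | 0, _, _ => []
  | k + 1, ns, es =>
    match r.nextOp ns es with
    | none => []
    | some (PlanOp.root i) => PlanOp.root i :: r.planFrom k (i :: ns) es
    | some (PlanOp.node i) => PlanOp.node i :: r.planFrom k (i :: ns) es
    | some (PlanOp.edge e) => PlanOp.edge e :: r.planFrom k (r.src e :: r.tgt e :: ns) (e :: es)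

/-- The search plan of a rule. Each operation matches a new item, so `n + m` operations do. -/
def Rule.searchPlan (r : Rule) : List (PlanOp r.n r.m) := r.planFrom (r.n + r.m) [] []

/-- The items matched so far. -/
@[ext] structure PartialMatch (r : Rule) (V E : Type) where
  node : Fin r.n → Option V
  edge : Fin r.m → Option E

/-- Run through a list of candidates, each of which consists of `w` host graph items.
A candidate costs one fetch, and `w` tests for being already matched and `w` comparisons.
For a candidate that passes (`ok`), the `w` flags are set and the search goes on with `next`;
if that is unsuccessful the `w` flags are cleared. The end of the list costs one more fetch. -/
noncomputable def tryCandidates {α β : Type} (w : ℕ) (ok : α → Prop) (next : α → Option β × ℕ) :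
    List α → Option β × ℕ
  | [] => (none, 1)
  | a :: as =>
    open Classical in
    if ok a then
      match next a with
      | (some q, k) => (some q, 1 + 2 * w + w + k)
      | (none, k) =>
        ((tryCandidates w ok next as).1,
          1 + 2 * w + w + k + w + (tryCandidates w ok next as).2)
    else
      ((tryCandidates w ok next as).1, 1 + 2 * w + (tryCandidates w ok next as).2)

/-- Search with `a`, and if that is unsuccessful search with `b`; the costs add up. -/
def searchOr {β : Type} (a b : Option β × ℕ) : Option β × ℕ :=
  match a with
  | (some q, k) => (some q, k)
  | (none, k) => (b.1, k + b.2)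

/-- The host node `v` can be matched with the so far unmatched node `i` of the rule. -/
def nodeOk {r : Rule} (G : HostGraph V E) (p : PartialMatch r V E) (i : Fin r.n) (v : V) : Prop :=
  (∀ j, p.node j ≠ some v) ∧ G.nodeMark v = r.lhsNodeMark i ∧ G.isRoot v = r.lhsRoot i

/-- The host edge `x`, whose other end is `v`, can be matched with the so far unmatched edge `e` of
the rule, whose other end is `j`. -/
def edgeOk {r : Rule} (G : HostGraph V E) (p : PartialMatch r V E) (e : Fin r.m) (j : Fin r.n)
    (x : E) (v : V) : Prop :=
  (∀ e', p.edge e' ≠ some x) ∧ G.edgeMark x = r.lhsEdgeMark e ∧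
    (p.node j = some v ∨ (p.node j = none ∧ nodeOk G p j v))

/-- Run the rest of a search plan from a partial match. The result is the first match found (`none`
if there is none), together with the number of basic operations. -/
noncomputable def search {r : Rule} {G : HostGraph V E} (π : Layout G) :
    List (PlanOp r.n r.m) → PartialMatch r V E → Option (PartialMatch r V E) × ℕ
  | [], p => (some p, 0)
  | PlanOp.root i :: ops, p =>
    tryCandidates 1 (fun v => nodeOk G p i v)
      (fun v => search π ops ⟨Function.update p.node i (some v), p.edge⟩) π.roots
  | PlanOp.node i :: ops, p =>
    tryCandidates 1 (fun v => nodeOk G p i v)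
      (fun v => search π ops ⟨Function.update p.node i (some v), p.edge⟩) π.nodes
  | PlanOp.edge e :: ops, p =>
    let along (j : Fin r.n) (far : E → V) (l : List E) :=
      tryCandidates 2 (fun x => edgeOk G p e j x (far x))
        (fun x => search π ops
          ⟨Function.update p.node j (some (far x)), Function.update p.edge e (some x)⟩) l
    match p.node (r.src e), p.node (r.tgt e) with
    | some v, _ =>
      if r.bidir e = true then
        searchOr (along (r.tgt e) G.tgt (π.outEdges v)) (along (r.tgt e) G.src (π.inEdges v))
      else along (r.tgt e) G.tgt (π.outEdges v)
    | none, some v =>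
      if r.bidir e = true then
        searchOr (along (r.src e) G.src (π.inEdges v)) (along (r.src e) G.tgt (π.outEdges v))
      else along (r.src e) G.src (π.inEdges v)
    | none, none => (none, 0)

/-- The search for a match of `r` in a host graph that is stored as `π`. -/
noncomputable def findMatch (r : Rule) {G : HostGraph V E} (π : Layout G) :
    Option (PartialMatch r V E) × ℕ :=
  search π r.searchPlan ⟨fun _ => none, fun _ => none⟩

/-- A successful call of `r` on `G`, with result `H` and `k` basic operations: the search finds the
match `g`, and then each matched item is rewritten and its flag cleared. -/
def CallSucceeds (r : Rule) (G H : HostGraph V E) (k : ℕ) : Prop :=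
  ∃ (g : Match r G) (π : Layout G) (k₀ : ℕ),
    findMatch r π = (some ⟨fun i => some (g.node i), fun e => some (g.edge e)⟩, k₀) ∧
      H = g.result ∧ k = k₀ + 2 * (r.n + r.m)

/-- A failing call of `r` on `G`, with `k` basic operations: `r` has no match in `G`, and the search
finds none. -/
def CallFails (r : Rule) (G : HostGraph V E) (k : ℕ) : Prop :=
  IsEmpty (Match r G) ∧ ∃ π : Layout G, findMatch r π = (none, k)

/-! ### Programs and their operational semantics -/

/-- Command sequences over a set `ι` of names of rules. -/
inductive Command (ι : Type) where
  | call (r : ι)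
  | seq (P Q : Command ι)
  | ifThenElse (C P Q : Command ι)
  | tryThenElse (C P Q : Command ι)
  | loop (P : Command ι)
  | brk
  | skip
  | failure
  | or (P Q : Command ι)
  | ifThen (C P : Command ι)
  | tryThen (C P : Command ι)
  | tryElse (C P : Command ι)
  | tryOnly (C : Command ι)

/-- Configurations: a command sequence with a host graph, a host graph, or fail. -/
inductive Config (ι V E : Type) where
  | run (P : Command ι) (G : HostGraph V E)
  | result (G : HostGraph V E)
  | fail

/-- What an execution does: call a rule (successfully or not, with the given number of basic
operations), execute `break`, execute `fail`, or transfer control in any other way. -/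
inductive Event (ι : Type) where
  | call (r : ι) (k : ℕ)
  | brk
  | failure
  | control

/-- The time an event takes. -/
def Event.cost {ι : Type} : Event ι → ℕ
  | Event.call _ k => k
  | Event.brk => 1
  | Event.failure => 1
  | Event.control => 1

/-- Whether the event is a call of the rule `r`. -/
def Event.isCallOf {ι : Type} [DecidableEq ι] (r : ι) : Event ι → Bool
  | Event.call r' _ => decide (r' = r)
  | _ => false

variable {ι : Type}

mutual

/-- The transition relation on configurations, annotated with the events that take place; `env`
gives the declarations of the rules. As `⟨C, G⟩` is neither a graph nor fail, `⟨C, G⟩ →⁺ H` is the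
same as `⟨C, G⟩ →* H`, and likewise for fail. -/
inductive Step (env : ι → Rule) : Config ι V E → List (Event ι) → Config ι V E → Prop
  | call₁ {r : ι} {G H : HostGraph V E} {k : ℕ} :
      CallSucceeds (env r) G H k → Step env (.run (.call r) G) [.call r k] (.result H)
  | call₂ {r : ι} {G : HostGraph V E} {k : ℕ} :
      CallFails (env r) G k → Step env (.run (.call r) G) [.call r k] .fail
  | seq₁ {P P' Q : Command ι} {G H : HostGraph V E} {tr : List (Event ι)} :
      Step env (.run P G) tr (.run P' H) → Step env (.run (.seq P Q) G) tr (.run (.seq P' Q) H)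
  | seq₂ {P Q : Command ι} {G H : HostGraph V E} {tr : List (Event ι)} :
      Step env (.run P G) tr (.result H) → Step env (.run (.seq P Q) G) tr (.run Q H)
  | seq₃ {P Q : Command ι} {G : HostGraph V E} {tr : List (Event ι)} :
      Step env (.run P G) tr .fail → Step env (.run (.seq P Q) G) tr .fail
  | if₁ {C P Q : Command ι} {G H : HostGraph V E} {tr : List (Event ι)} :
      Run env (.run C G) tr (.result H) →
        Step env (.run (.ifThenElse C P Q) G) (tr ++ [.control]) (.run P G)
  | if₂ {C P Q : Command ι} {G : HostGraph V E} {tr : List (Event ι)} :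
      Run env (.run C G) tr .fail →
        Step env (.run (.ifThenElse C P Q) G) (tr ++ [.control]) (.run Q G)
  | try₁ {C P Q : Command ι} {G H : HostGraph V E} {tr : List (Event ι)} :
      Run env (.run C G) tr (.result H) →
        Step env (.run (.tryThenElse C P Q) G) (tr ++ [.control]) (.run P H)
  | try₂ {C P Q : Command ι} {G : HostGraph V E} {tr : List (Event ι)} :
      Run env (.run C G) tr .fail →
        Step env (.run (.tryThenElse C P Q) G) (tr ++ [.control]) (.run Q G)
  | alap₁ {P : Command ι} {G H : HostGraph V E} {tr : List (Event ι)} :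
      Run env (.run P G) tr (.result H) →
        Step env (.run (.loop P) G) (tr ++ [.control]) (.run (.loop P) H)
  | alap₂ {P : Command ι} {G : HostGraph V E} {tr : List (Event ι)} :
      Run env (.run P G) tr .fail →
        Step env (.run (.loop P) G) (tr ++ [.control]) (.result G)
  | alap₃ {P : Command ι} {G H : HostGraph V E} {tr : List (Event ι)} :
      Run env (.run P G) tr (.run .brk H) →
        Step env (.run (.loop P) G) (tr ++ [.brk]) (.result H)
  | brk {P : Command ι} {G : HostGraph V E} :
      Step env (.run (.seq .brk P) G) [.control] (.run .brk G)
  | or₁ {P Q : Command ι} {G : HostGraph V E} :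
      Step env (.run (.or P Q) G) [.control] (.run P G)
  | or₂ {P Q : Command ι} {G : HostGraph V E} :
      Step env (.run (.or P Q) G) [.control] (.run Q G)
  | skip {G : HostGraph V E} : Step env (.run .skip G) [.control] (.result G)
  | failure {G : HostGraph V E} : Step env (.run .failure G) [.failure] .fail
  | if₃ {C P : Command ι} {G : HostGraph V E} :
      Step env (.run (.ifThen C P) G) [.control] (.run (.ifThenElse C P .skip) G)
  | try₃ {C P : Command ι} {G : HostGraph V E} :
      Step env (.run (.tryThen C P) G) [.control] (.run (.tryThenElse C P .skip) G)
  | try₄ {C P : Command ι} {G : HostGraph V E} :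
      Step env (.run (.tryElse C P) G) [.control] (.run (.tryThenElse C .skip P) G)
  | try₅ {C : Command ι} {G : HostGraph V E} :
      Step env (.run (.tryOnly C) G) [.control] (.run (.tryThenElse C .skip .skip) G)

/-- The reflexive-transitive closure of the transition relation; the events are concatenated. -/
inductive Run (env : ι → Rule) : Config ι V E → List (Event ι) → Config ι V E → Prop
  | refl (c : Config ι V E) : Run env c [] c
  | head {c c' c'' : Config ι V E} {tr tr' : List (Event ι)} :
      Step env c tr c' → Run env c' tr' c'' → Run env c (tr ++ tr') c''

end

/-- The execution of the first configuration involves the nested execution of the second one, which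
is the condition of a conditional or the body of a loop. -/
inductive Enters : Config ι V E → Config ι V E → Prop
  | ifThenElse {C P Q : Command ι} {G : HostGraph V E} :
      Enters (.run (.ifThenElse C P Q) G) (.run C G)
  | tryThenElse {C P Q : Command ι} {G : HostGraph V E} :
      Enters (.run (.tryThenElse C P Q) G) (.run C G)
  | loop {P : Command ι} {G : HostGraph V E} : Enters (.run (.loop P) G) (.run P G)
  | seq {P Q : Command ι} {G : HostGraph V E} {c : Config ι V E} :
      Enters (.run P G) c → Enters (.run (.seq P Q) G) c

/-- `P` can diverge from `G`: there is an infinite sequence of transitions, where we also count an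
infinite sequence inside a nested execution. -/
def CanDiverge (env : ι → Rule) (P : Command ι) (G : HostGraph V E) : Prop :=
  ∃ f : ℕ → Config ι V E, f 0 = .run P G ∧
    ∀ i, (∃ tr, Step env (f i) tr (f (i + 1))) ∨ Enters (f i) (f (i + 1))

/-- `P` can get stuck from `G`: an execution reaches a terminal configuration that is neither a
graph nor fail. -/
def CanGetStuck (env : ι → Rule) (P : Command ι) (G : HostGraph V E) : Prop :=
  ∃ (tr : List (Event ι)) (Q : Command ι) (H : HostGraph V E),
    Run env (.run P G) tr (.run Q H) ∧ ∀ tr' c, ¬ Step env (.run Q H) tr' c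

/-- `P` terminates on `G`: each execution ends with a graph or with fail. -/
def Terminates (env : ι → Rule) (P : Command ι) (G : HostGraph V E) : Prop :=
  ¬ CanDiverge env P G ∧ ¬ CanGetStuck env P G

/-! ### Complexity -/

/-- The time that is spent on the events of an execution. -/
def time (tr : List (Event ι)) : ℕ := (tr.map Event.cost).sum

/-- The running time on the input graph `G` of an execution with events `tr`: parsing and loading
`G`, executing the program, and writing the output graph (which is as large as `G`). -/
noncomputable def runningTime (G : HostGraph V E) (tr : List (Event ι)) : ℕ :=
  G.size + time tr + G.size

/-- How many times the rule `r` is called. -/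
def numCalls [DecidableEq ι] (r : ι) (tr : List (Event ι)) : ℕ := tr.countP (Event.isCallOf r)

/-- The class of input graphs whose nodes have degree at most `d`. -/
def InputOfDegreeLE (d : ℕ) (G : HostGraph V E) : Prop := G.IsInput ∧ ∀ v, G.degree v ≤ d

/-- On all input graphs of size `N` and node degree at most `d`, in every execution of `P`, each rule
`r` is called at most `s r N` times, and each call takes at most `t r N` basic operations (which
include the inspection of every candidate for a match). -/
def IsBoundedBy [DecidableEq ι] (env : ι → Rule) (P : Command ι) (d : ℕ) (s t : ι → ℕ → ℕ) : Prop :=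
  ∀ (V E : Type) [Finite V] [Finite E] (G : HostGraph V E), InputOfDegreeLE d G →
    ∀ (tr : List (Event ι)) (c : Config ι V E), Run env (.run P G) tr c →
      ∀ r : ι, numCalls r tr ≤ s r G.size ∧ ∀ k, Event.call r k ∈ tr → k ≤ t r G.size

/-- The complexity measure `K(P) = ∑ r, K(r)` with `K(r) = s(r) * t(r)`. -/
def complexityMeasure [Fintype ι] (s t : ι → ℕ → ℕ) (N : ℕ) : ℕ := ∑ r, s r N * t r N

/-! ### The program is-connected -/

namespace IsConnected

/-- The names of the rules; `check` is the rule called `match` in GP 2. -/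
inductive RuleName where
  | init | check | forward | back
  deriving DecidableEq

instance : Fintype RuleName where
  elems := {.init, .check, .forward, .back}
  complete := by intro r; cases r <;> decide

/-- A grey node becomes a blue root. -/
abbrev init : Rule where
  n := 1
  m := 0
  src := ![]
  tgt := ![]
  bidir := ![]
  lhsNodeMark := ![.grey]
  lhsRoot := ![false]
  lhsEdgeMark := ![]
  rhsNodeLabel := ![.inl 0]
  rhsNodeMark := ![.blue]
  rhsRoot := ![true]
  rhsEdgeLabel := ![]
  rhsEdgeMark := ![]

/-- A grey node is left as it is. -/
abbrev check : Rule where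
  n := 1
  m := 0
  src := ![]
  tgt := ![]
  bidir := ![]
  lhsNodeMark := ![.grey]
  lhsRoot := ![false]
  lhsEdgeMark := ![]
  rhsNodeLabel := ![.inl 0]
  rhsNodeMark := ![.grey]
  rhsRoot := ![false]
  rhsEdgeLabel := ![]
  rhsEdgeMark := ![]

/-- From a blue root along an unmarked edge of either direction to a grey node, which becomes the
blue root; the edge becomes dashed. -/
abbrev forward : Rule where
  n := 2
  m := 1
  src := ![0]
  tgt := ![1]
  bidir := ![true]
  lhsNodeMark := ![.blue, .grey]
  lhsRoot := ![true, false]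
  lhsEdgeMark := ![.unmarked]
  rhsNodeLabel := ![.inl 0, .inl 1]
  rhsNodeMark := ![.blue, .blue]
  rhsRoot := ![false, true]
  rhsEdgeLabel := ![.inr 0]
  rhsEdgeMark := ![.dashed]

/-- From a blue root back along a dashed edge of either direction to a blue node, which becomes the
root; the former root and the edge become unmarked. -/
abbrev back : Rule where
  n := 2
  m := 1
  src := ![0]
  tgt := ![1]
  bidir := ![true]
  lhsNodeMark := ![.blue, .blue]
  lhsRoot := ![false, true]
  lhsEdgeMark := ![.dashed]
  rhsNodeLabel := ![.inl 0, .inl 1]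
  rhsNodeMark := ![.blue, .unmarked]
  rhsRoot := ![true, false]
  rhsEdgeLabel := ![.inr 0]
  rhsEdgeMark := ![.unmarked]

/-- The rule declarations. -/
def rules : RuleName → Rule
  | .init => init
  | .check => check
  | .forward => forward
  | .back => back

/-- `DFS = forward!; try back else break` -/
def dfs : Command RuleName :=
  .seq (.loop (.call .forward)) (.tryElse (.call .back) .brk)

/-- `Check = if match then fail` -/
def checkProc : Command RuleName := .ifThen (.call .check) .failure

/-- `Main = try init then (DFS!; Check)` -/
def main : Command RuleName := .tryThen (.call .init) (.seq (.loop dfs) checkProc)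

end IsConnected

end GP2

-- Give a grey node potential 2, a blue node potential 1 and any other node 0. An application of
-- `forward` or `back` lowers the sum over all nodes by exactly 1 (`Match.potential_result`), and
-- `init` does not raise it. Hence there are at most 2|V| such applications, and between two of them
-- lie only boundedly many failing calls and control transfers.
--
-- Single calls are cheap. Once `init` has succeeded there is at most one root, so a search for
-- `forward` or `back` looks at one root and its at most `d` outgoing and `d` incoming edges. On an
-- input graph `init` accepts the first node of the list. Only `check` scans all nodes, and it is
-- called at most once.
--
-- The accounting uses weights: a call of `check` weighs size + 1, any other event 1, and each event
-- costs at most `unitCost d` times its weight. `BodyBudget` and `MainBudget` attach to every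
-- reachable configuration a number that bounds the weight still to come and that drops strictly at
-- each transition. This gives both the linear bound (`main_weight_le`) and, once nested executions
-- are included (`NestedBudget`), the absence of divergence. Executions cannot get stuck because the
-- search finds a match whenever there is one (`searchCorrect`), so each call succeeds or fails, and
-- because the body of `DFS!` always runs to a graph or to `break`.

namespace GP2

-- Soundness, completeness and cost of the backtracking search.

section Search

variable {V E : Type}

theorem exists_mem_of_tryCandidates_eq_some {α β : Type} {w : ℕ} {ok : α → Prop}
    {next : α → Option β × ℕ} {q : β} :
    ∀ {l : List α}, (tryCandidates w ok next l).1 = some q →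
      ∃ a ∈ l, ok a ∧ (next a).1 = some q
  | [], h => by simp [tryCandidates] at h
  | a :: l, h => by
    by_cases ha : ok a
    · rcases hn : next a with ⟨_ | q', k⟩
      · simp only [tryCandidates, ha, hn, if_true] at h
        obtain ⟨b, hb, h'⟩ := exists_mem_of_tryCandidates_eq_some h
        exact ⟨b, List.mem_cons_of_mem _ hb, h'⟩
      · simp only [tryCandidates, ha, hn, if_true] at h
        exact ⟨a, List.mem_cons_self, ha, by rw [hn]; exact h⟩
    · simp only [tryCandidates, ha, if_false] at h
      obtain ⟨b, hb, h'⟩ := exists_mem_of_tryCandidates_eq_some h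
      exact ⟨b, List.mem_cons_of_mem _ hb, h'⟩

theorem next_eq_none_of_tryCandidates_eq_none {α β : Type} {w : ℕ} {ok : α → Prop}
    {next : α → Option β × ℕ} :
    ∀ {l : List α}, (tryCandidates w ok next l).1 = none →
      ∀ a ∈ l, ok a → (next a).1 = none
  | [], _ => by simp
  | a :: l, h => by
    by_cases ha : ok a
    · rcases hn : next a with ⟨_ | q', k⟩
      · simp only [tryCandidates, ha, hn, if_true] at h
        have := next_eq_none_of_tryCandidates_eq_none h
        simp [hn]
        exact this
      · simp [tryCandidates, ha, hn] at h
    · simp only [tryCandidates, ha, if_false] at h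
      have := next_eq_none_of_tryCandidates_eq_none h
      simp [ha]
      exact this

/-- The dearest candidate passes and then leads nowhere: one fetch, `w` tests, `w` comparisons, `w`
flags set and `w` cleared, plus the nested search. The extra 1 is the fetch at the end of the list.
-/
theorem tryCandidates_cost_le {α β : Type} {w : ℕ} {ok : α → Prop}
    {next : α → Option β × ℕ} {B : ℕ} (hB : ∀ a, (next a).2 ≤ B) :
    ∀ l : List α, (tryCandidates w ok next l).2 ≤ 1 + l.length * (1 + 4 * w + B)
  | [] => by simp [tryCandidates]
  | a :: l => by
    have ih := tryCandidates_cost_le (w := w) (ok := ok) hB l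
    have hb := hB a
    rw [List.length_cons, add_mul, one_mul]
    by_cases ha : ok a
    · rcases hn : next a with ⟨_ | q', k⟩ <;> rw [hn] at hb <;> dsimp only at hb <;>
        simp only [tryCandidates, ha, hn, if_true]
      · omega
      · generalize l.length * (1 + 4 * w + B) = x
        omega
    · simp only [tryCandidates, ha, if_false]
      omega

theorem searchOr_eq_some {β : Type} {a b : Option β × ℕ} {q : β} (h : (searchOr a b).1 = some q) :
    a.1 = some q ∨ b.1 = some q := by
  rcases a with ⟨_ | q', k⟩
  · exact Or.inr h
  · exact Or.inl h

theorem searchOr_eq_none {β : Type} {a b : Option β × ℕ} (h : (searchOr a b).1 = none) :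
    a.1 = none ∧ b.1 = none := by
  rcases a with ⟨_ | q', k⟩
  · exact ⟨rfl, h⟩
  · cases h

theorem searchOr_cost_le {β : Type} (a b : Option β × ℕ) : (searchOr a b).2 ≤ a.2 + b.2 := by
  rcases a with ⟨_ | q', k⟩
  · exact le_rfl
  · exact Nat.le_add_right _ _

theorem length_le_natCard_of_nodup {α : Type} [Finite α] {p : α → Prop} {l : List α}
    (hl : l.Nodup) (h : ∀ a ∈ l, p a) : l.length ≤ Nat.card {a // p a} := by
  have hinj : Function.Injective fun i : Fin l.length =>
      (⟨l.get i, h _ (l.get_mem i)⟩ : {a // p a}) :=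
    fun i j hij => hl.injective_get (Subtype.ext_iff.mp hij)
  simpa using Nat.card_le_card_of_injective _ hinj

theorem nonempty_layout [Finite V] [Finite E] (G : HostGraph V E) : Nonempty (Layout G) := by
  classical
  have := Fintype.ofFinite V
  have := Fintype.ofFinite E
  exact ⟨{
    nodes := Finset.univ.toList
    roots := (Finset.univ.filter fun v => G.isRoot v = true).toList
    outEdges := fun v => (Finset.univ.filter fun e => G.src e = v).toList
    inEdges := fun v => (Finset.univ.filter fun e => G.tgt e = v).toList
    nodes_nodup := Finset.nodup_toList _
    mem_nodes := by simp
    roots_nodup := Finset.nodup_toList _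
    mem_roots := by simp
    outEdges_nodup := fun _ => Finset.nodup_toList _
    mem_outEdges := by simp
    inEdges_nodup := fun _ => Finset.nodup_toList _
    mem_inEdges := by simp }⟩

/-- The edge `x` joins the nodes `u` and `v`, in either direction. -/
def HostGraph.Joins (G : HostGraph V E) (x : E) (u v : V) : Prop :=
  (G.src x = u ∧ G.tgt x = v) ∨ (G.src x = v ∧ G.tgt x = u)

/-- In `forward` and `back` the edge is the last item of the search plan, so the continuation after
it succeeds at no cost. -/
theorem search_edge_of_src {r : Rule} {G : HostGraph V E} (π : Layout G) {p : PartialMatch r V E}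
    {e : Fin r.m} {u : V} (hb : r.bidir e = true) (hu : p.node (r.src e) = some u) :
    search π [.edge e] p = searchOr
      (tryCandidates 2 (fun x => edgeOk G p e (r.tgt e) x (G.tgt x))
        (fun x => (some ⟨Function.update p.node (r.tgt e) (some (G.tgt x)),
          Function.update p.edge e (some x)⟩, 0)) (π.outEdges u))
      (tryCandidates 2 (fun x => edgeOk G p e (r.tgt e) x (G.src x))
        (fun x => (some ⟨Function.update p.node (r.tgt e) (some (G.src x)),
          Function.update p.edge e (some x)⟩, 0)) (π.inEdges u)) := by
  simp only [search, hu, hb, if_true]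

theorem search_edge_of_tgt {r : Rule} {G : HostGraph V E} (π : Layout G) {p : PartialMatch r V E}
    {e : Fin r.m} {u : V} (hb : r.bidir e = true) (hn : p.node (r.src e) = none)
    (hu : p.node (r.tgt e) = some u) :
    search π [.edge e] p = searchOr
      (tryCandidates 2 (fun x => edgeOk G p e (r.src e) x (G.src x))
        (fun x => (some ⟨Function.update p.node (r.src e) (some (G.src x)),
          Function.update p.edge e (some x)⟩, 0)) (π.inEdges u))
      (tryCandidates 2 (fun x => edgeOk G p e (r.src e) x (G.tgt x))
        (fun x => (some ⟨Function.update p.node (r.src e) (some (G.tgt x)),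
          Function.update p.edge e (some x)⟩, 0)) (π.outEdges u)) := by
  simp only [search, hn, hu, hb, if_true]

theorem exists_of_search_edge_of_src_eq_some {r : Rule} {G : HostGraph V E} (π : Layout G)
    {p q : PartialMatch r V E} {e : Fin r.m} {u : V} (hb : r.bidir e = true)
    (hu : p.node (r.src e) = some u) (h : (search π [.edge e] p).1 = some q) :
    ∃ x v, G.Joins x u v ∧ edgeOk G p e (r.tgt e) x v ∧
      q = ⟨Function.update p.node (r.tgt e) (some v), Function.update p.edge e (some x)⟩ := by
  rw [search_edge_of_src π hb hu] at h
  rcases searchOr_eq_some h with h | h <;>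
    obtain ⟨x, hx, hok, hq⟩ := exists_mem_of_tryCandidates_eq_some h
  · exact ⟨x, G.tgt x, Or.inl ⟨(π.mem_outEdges _ _).1 hx, rfl⟩, hok, (Option.some.inj hq).symm⟩
  · exact ⟨x, G.src x, Or.inr ⟨rfl, (π.mem_inEdges _ _).1 hx⟩, hok, (Option.some.inj hq).symm⟩

theorem exists_of_search_edge_of_tgt_eq_some {r : Rule} {G : HostGraph V E} (π : Layout G)
    {p q : PartialMatch r V E} {e : Fin r.m} {u : V} (hb : r.bidir e = true)
    (hn : p.node (r.src e) = none) (hu : p.node (r.tgt e) = some u)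
    (h : (search π [.edge e] p).1 = some q) :
    ∃ x v, G.Joins x u v ∧ edgeOk G p e (r.src e) x v ∧
      q = ⟨Function.update p.node (r.src e) (some v), Function.update p.edge e (some x)⟩ := by
  rw [search_edge_of_tgt π hb hn hu] at h
  rcases searchOr_eq_some h with h | h <;>
    obtain ⟨x, hx, hok, hq⟩ := exists_mem_of_tryCandidates_eq_some h
  · exact ⟨x, G.src x, Or.inr ⟨rfl, (π.mem_inEdges _ _).1 hx⟩, hok, (Option.some.inj hq).symm⟩
  · exact ⟨x, G.tgt x, Or.inl ⟨(π.mem_outEdges _ _).1 hx, rfl⟩, hok, (Option.some.inj hq).symm⟩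

theorem not_edgeOk_of_search_edge_of_src_eq_none {r : Rule} {G : HostGraph V E} (π : Layout G)
    {p : PartialMatch r V E} {e : Fin r.m} {u v : V} {x : E} (hb : r.bidir e = true)
    (hu : p.node (r.src e) = some u) (h : (search π [.edge e] p).1 = none) (hx : G.Joins x u v) :
    ¬ edgeOk G p e (r.tgt e) x v := by
  intro hok
  rw [search_edge_of_src π hb hu] at h
  obtain ⟨h₁, h₂⟩ := searchOr_eq_none h
  rcases hx with ⟨rfl, rfl⟩ | ⟨rfl, rfl⟩
  · cases next_eq_none_of_tryCandidates_eq_none h₁ x ((π.mem_outEdges _ _).2 rfl) hok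
  · cases next_eq_none_of_tryCandidates_eq_none h₂ x ((π.mem_inEdges _ _).2 rfl) hok

theorem not_edgeOk_of_search_edge_of_tgt_eq_none {r : Rule} {G : HostGraph V E} (π : Layout G)
    {p : PartialMatch r V E} {e : Fin r.m} {u v : V} {x : E} (hb : r.bidir e = true)
    (hn : p.node (r.src e) = none) (hu : p.node (r.tgt e) = some u)
    (h : (search π [.edge e] p).1 = none) (hx : G.Joins x u v) :
    ¬ edgeOk G p e (r.src e) x v := by
  intro hok
  rw [search_edge_of_tgt π hb hn hu] at h
  obtain ⟨h₁, h₂⟩ := searchOr_eq_none h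
  rcases hx with ⟨rfl, rfl⟩ | ⟨rfl, rfl⟩
  · cases next_eq_none_of_tryCandidates_eq_none h₂ x ((π.mem_outEdges _ _).2 rfl) hok
  · cases next_eq_none_of_tryCandidates_eq_none h₁ x ((π.mem_inEdges _ _).2 rfl) hok

theorem Layout.length_outEdges_le [Finite E] {G : HostGraph V E} (π : Layout G) (v : V) :
    (π.outEdges v).length ≤ G.degree v :=
  (length_le_natCard_of_nodup (π.outEdges_nodup v) fun e => (π.mem_outEdges v e).1).trans
    (Nat.le_add_right _ _)

theorem Layout.length_inEdges_le [Finite E] {G : HostGraph V E} (π : Layout G) (v : V) :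
    (π.inEdges v).length ≤ G.degree v :=
  (length_le_natCard_of_nodup (π.inEdges_nodup v) fun e => (π.mem_inEdges v e).1).trans
    (Nat.le_add_left _ _)

theorem Layout.length_nodes_le [Finite V] {G : HostGraph V E} (π : Layout G) :
    π.nodes.length ≤ Nat.card V := by
  simpa using Nat.card_le_card_of_injective _ π.nodes_nodup.injective_get

theorem Layout.length_roots_le {G : HostGraph V E} (π : Layout G)
    (h : ∀ u v, G.isRoot u = true → G.isRoot v = true → u = v) : π.roots.length ≤ 1 := by
  rcases hl : π.roots with _ | ⟨u, _ | ⟨v, l⟩⟩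
  · simp
  · simp
  · have hu := (π.mem_roots u).1 (by simp [hl])
    have hv := (π.mem_roots v).1 (by simp [hl])
    have hnd := π.roots_nodup
    simp [hl, h u v hu hv] at hnd

/-- At most two lists are scanned, each with at most `d` edges. An edge is tried together with its
far end, so it costs 1 + 4 · 2 = 9, and each list end costs 1. -/
theorem search_edge_cost_le [Finite E] {r : Rule} {G : HostGraph V E} (π : Layout G)
    (p : PartialMatch r V E) (e : Fin r.m) {d : ℕ} (hd : ∀ v, G.degree v ≤ d) :
    (search π [.edge e] p).2 ≤ 2 + 18 * d := by
  have hout : ∀ (ok : E → Prop) (next : E → PartialMatch r V E) (v : V),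
      (tryCandidates 2 ok (fun x => (some (next x), 0)) (π.outEdges v)).2 ≤ 1 + 9 * d := by
    intro ok next v
    refine (tryCandidates_cost_le (B := 0) (fun _ => le_rfl) _).trans ?_
    have := (π.length_outEdges_le v).trans (hd v)
    omega
  have hin : ∀ (ok : E → Prop) (next : E → PartialMatch r V E) (v : V),
      (tryCandidates 2 ok (fun x => (some (next x), 0)) (π.inEdges v)).2 ≤ 1 + 9 * d := by
    intro ok next v
    refine (tryCandidates_cost_le (B := 0) (fun _ => le_rfl) _).trans ?_
    have := (π.length_inEdges_le v).trans (hd v)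
    omega
  rcases hs : p.node (r.src e) with _ | u
  · rcases ht : p.node (r.tgt e) with _ | u
    · simp only [search, hs, ht]
      omega
    · by_cases hb : r.bidir e = true
      · simp only [search, hs, ht, hb, if_true]
        refine (searchOr_cost_le _ _).trans ((Nat.add_le_add (hin _ _ _) (hout _ _ _)).trans ?_)
        omega
      · simp only [search, hs, ht, hb]
        refine (hin _ _ _).trans ?_
        omega
  · by_cases hb : r.bidir e = true
    · simp only [search, hs, hb, if_true]
      refine (searchOr_cost_le _ _).trans ((Nat.add_le_add (hout _ _ _) (hin _ _ _)).trans ?_)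
      omega
    · simp only [search, hs, hb]
      refine (hout _ _ _).trans ?_
      omega

theorem search_root_edge_cost_le [Finite E] {r : Rule} {G : HostGraph V E} (π : Layout G)
    (p : PartialMatch r V E) (i : Fin r.n) (e : Fin r.m) {d : ℕ} (hd : ∀ v, G.degree v ≤ d)
    (h : ∀ u v, G.isRoot u = true → G.isRoot v = true → u = v) :
    (search π [.root i, .edge e] p).2 ≤ 8 + 18 * d := by
  rw [search]
  refine (tryCandidates_cost_le (fun v => search_edge_cost_le π _ e hd) _).trans ?_
  have := Nat.mul_le_mul_right (1 + 4 * 1 + (2 + 18 * d)) (π.length_roots_le h)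
  omega

end Search

-- Correctness of the search for each of the four rules.

namespace IsConnected

variable {V E : Type} {G : HostGraph V E}

/-- The search for a match of `r` finds one if there is one. -/
def SearchCorrect (r : Rule) (π : Layout G) : Prop :=
  (∀ p, (findMatch r π).1 = some p →
    ∃ g : Match r G, p = ⟨fun i => some (g.node i), fun e => some (g.edge e)⟩) ∧
  ((findMatch r π).1 = none → IsEmpty (Match r G))

theorem searchCorrect_init (π : Layout G) : SearchCorrect init π := by
  constructor
  · intro p hp
    obtain ⟨v, -, hok, hq⟩ := exists_mem_of_tryCandidates_eq_some hp
    refine ⟨⟨![v], Fin.elim0, Function.injective_of_subsingleton _, fun i => i.elim0,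
      fun i => i.elim0, fun i => ?_, fun i => ?_, fun i => i.elim0⟩, ?_⟩
    · fin_cases i; exact hok.2.1
    · fin_cases i; exact hok.2.2
    · rw [← Option.some.inj hq]
      ext i : 2
      · fin_cases i; rfl
      · exact i.elim0
  · intro hp
    refine ⟨fun g => ?_⟩
    cases next_eq_none_of_tryCandidates_eq_none hp (g.node 0) (π.mem_nodes _)
      ⟨fun _ => by simp, g.nodeMark 0, g.isRoot 0⟩

theorem searchCorrect_check (π : Layout G) : SearchCorrect check π := by
  constructor
  · intro p hp
    obtain ⟨v, -, hok, hq⟩ := exists_mem_of_tryCandidates_eq_some hp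
    refine ⟨⟨![v], Fin.elim0, Function.injective_of_subsingleton _, fun i => i.elim0,
      fun i => i.elim0, fun i => ?_, fun i => ?_, fun i => i.elim0⟩, ?_⟩
    · fin_cases i; exact hok.2.1
    · fin_cases i; exact hok.2.2
    · rw [← Option.some.inj hq]
      ext i : 2
      · fin_cases i; rfl
      · exact i.elim0
  · intro hp
    refine ⟨fun g => ?_⟩
    cases next_eq_none_of_tryCandidates_eq_none hp (g.node 0) (π.mem_nodes _)
      ⟨fun _ => by simp, g.nodeMark 0, g.isRoot 0⟩

theorem searchCorrect_forward (π : Layout G) : SearchCorrect forward π := by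
  constructor
  · intro p hp
    obtain ⟨u, -, hu, hq⟩ := exists_mem_of_tryCandidates_eq_some hp
    obtain ⟨x, v, hx, hxok, rfl⟩ := exists_of_search_edge_of_src_eq_some π (e := 0) (u := u) rfl
      rfl hq
    obtain ⟨-, hxm, hv | ⟨-, hv⟩⟩ := hxok
    -- Only the root is matched at this stage, so the far end of the edge cannot have been matched
    -- before.
    · cases hv
    have huv : u ≠ v := fun h => hv.1 0 (congrArg some h)
    refine ⟨⟨![u, v], ![x], ?_, Function.injective_of_subsingleton _, fun i => ?_, fun i => ?_,
      fun i => ?_, fun i => ?_⟩, ?_⟩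
    · intro i j hij
      fin_cases i <;> fin_cases j <;> simp_all
    · fin_cases i
      exact hx.imp id fun h => ⟨rfl, h⟩
    · fin_cases i
      exacts [hu.2.1, hv.2.1]
    · fin_cases i
      exacts [hu.2.2, hv.2.2]
    · fin_cases i
      exact hxm
    · ext i : 2 <;> fin_cases i <;> rfl
  · intro hp
    refine ⟨fun g => ?_⟩
    have hne : g.node 0 ≠ g.node 1 := fun h => by simpa using g.node_injective h
    have h := next_eq_none_of_tryCandidates_eq_none hp (g.node 0) ((π.mem_roots _).2 (g.isRoot 0))
      ⟨fun _ => by simp, g.nodeMark 0, g.isRoot 0⟩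
    refine not_edgeOk_of_search_edge_of_src_eq_none π (e := 0) (u := g.node 0) (v := g.node 1)
      (x := g.edge 0) rfl rfl h ((g.ends 0).imp id fun h => h.2)
      ⟨fun _ => by simp, g.edgeMark 0, Or.inr ⟨rfl, fun j => ?_, g.nodeMark 1, g.isRoot 1⟩⟩
    fin_cases j
    · exact fun h => hne (Option.some.inj h)
    · exact fun h => by cases h

theorem searchCorrect_back (π : Layout G) : SearchCorrect back π := by
  constructor
  · intro p hp
    obtain ⟨u, -, hu, hq⟩ := exists_mem_of_tryCandidates_eq_some hp
    -- The root of `back` is node 1, the target of its edge, so the edge is searched from its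
    -- target.
    obtain ⟨x, v, hx, hxok, rfl⟩ := exists_of_search_edge_of_tgt_eq_some π (e := 0) (u := u) rfl
      rfl rfl hq
    obtain ⟨-, hxm, hv | ⟨-, hv⟩⟩ := hxok
    · cases hv
    have huv : u ≠ v := fun h => hv.1 1 (congrArg some h)
    refine ⟨⟨![v, u], ![x], ?_, Function.injective_of_subsingleton _, fun i => ?_, fun i => ?_,
      fun i => ?_, fun i => ?_⟩, ?_⟩
    · intro i j hij
      fin_cases i <;> fin_cases j <;> simp_all
    · fin_cases i
      exact hx.symm.imp id fun h => ⟨rfl, h⟩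
    · fin_cases i
      exacts [hv.2.1, hu.2.1]
    · fin_cases i
      exacts [hv.2.2, hu.2.2]
    · fin_cases i
      exact hxm
    · ext i : 2 <;> fin_cases i <;> rfl
  · intro hp
    refine ⟨fun g => ?_⟩
    have hne : g.node 1 ≠ g.node 0 := fun h => by simpa using g.node_injective h
    have h := next_eq_none_of_tryCandidates_eq_none hp (g.node 1) ((π.mem_roots _).2 (g.isRoot 1))
      ⟨fun _ => by simp, g.nodeMark 1, g.isRoot 1⟩
    refine not_edgeOk_of_search_edge_of_tgt_eq_none π (e := 0) (u := g.node 1) (v := g.node 0)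
      (x := g.edge 0) rfl rfl rfl h ((g.ends 0).symm.imp (fun h => h.2) id)
      ⟨fun _ => by simp, g.edgeMark 0, Or.inr ⟨rfl, fun j => ?_, g.nodeMark 0, g.isRoot 0⟩⟩
    fin_cases j
    · exact fun h => by cases h
    · exact fun h => hne (Option.some.inj h)

theorem searchCorrect : ∀ (r : RuleName) (π : Layout G), SearchCorrect (rules r) π
  | .init => searchCorrect_init
  | .check => searchCorrect_check
  | .forward => searchCorrect_forward
  | .back => searchCorrect_back

/-- Any layout serves. Success needs soundness of the search, and failure needs completeness, as
`CallFails` demands that no match exists at all. -/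
theorem exists_call [Finite V] [Finite E] (r : RuleName) (G : HostGraph V E) :
    (∃ H k, CallSucceeds (rules r) G H k) ∨ ∃ k, CallFails (rules r) G k := by
  obtain ⟨π⟩ := nonempty_layout G
  rcases h : findMatch (rules r) π with ⟨_ | p, k⟩
  · exact Or.inr ⟨k, (searchCorrect r π).2 (by rw [h]), π, h⟩
  · obtain ⟨g, rfl⟩ := (searchCorrect r π).1 p (by rw [h])
    exact Or.inl ⟨_, _, g, π, k, h, rfl, rfl⟩

end IsConnected

-- Runs, calls and the budget principle.

section Execution

variable {V E ι : Type} {env : ι → Rule}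

/-- An invariant with a budget that pays for the events of a transition pays for those of a run. -/
theorem Run.budget {I : Config ι V E → ℕ → Prop} {w : Event ι → ℕ} {ok : Event ι → Prop}
    (hI : ∀ c n, I c n → ∀ tr c', Step env c tr c' →
      ∃ n' < n, I c' n' ∧ (tr.map w).sum + n' ≤ n ∧ ∀ e ∈ tr, ok e) :
    ∀ {c tr c'}, Run env c tr c' → ∀ n, I c n →
      ∃ n', I c' n' ∧ (tr.map w).sum + n' ≤ n ∧ ∀ e ∈ tr, ok e
  | _, _, _, .refl _, n, h => ⟨n, h, by simp, by simp⟩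
  | _, _, _, .head hs hr, n, h => by
    obtain ⟨n₁, -, h₁, hw₁, hok₁⟩ := hI _ _ h _ _ hs
    obtain ⟨n₂, h₂, hw₂, hok₂⟩ := Run.budget hI hr n₁ h₁
    refine ⟨n₂, h₂, ?_, fun e he => ?_⟩
    · rw [List.map_append, List.sum_append]
      omega
    · rcases List.mem_append.1 he with he | he
      exacts [hok₁ e he, hok₂ e he]

theorem Run.single {c c' : Config ι V E} {tr : List (Event ι)} (h : Step env c tr c') :
    Run env c tr c' := by
  simpa using Run.head h (Run.refl c')

theorem Run.eq_of_result {G : HostGraph V E} {tr : List (Event ι)} {c : Config ι V E}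
    (h : Run env (.result G) tr c) : tr = [] ∧ c = .result G := by
  cases h with
  | refl => exact ⟨rfl, rfl⟩
  | head h _ => cases h

theorem Run.eq_of_fail {tr : List (Event ι)} {c : Config ι V E}
    (h : Run env .fail tr c) : tr = [] ∧ c = .fail := by
  cases h with
  | refl => exact ⟨rfl, rfl⟩
  | head h _ => cases h

theorem Run.call_cases {r : ι} {G : HostGraph V E} {tr : List (Event ι)} {c : Config ι V E}
    (h : Run env (.run (.call r) G) tr c) :
    (tr = [] ∧ c = .run (.call r) G) ∨
      (∃ H k, CallSucceeds (env r) G H k ∧ tr = [.call r k] ∧ c = .result H) ∨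
      ∃ k, CallFails (env r) G k ∧ tr = [.call r k] ∧ c = .fail := by
  cases h with
  | refl => exact Or.inl ⟨rfl, rfl⟩
  | head hs hr =>
    cases hs with
    | call₁ hc =>
      obtain ⟨rfl, rfl⟩ := hr.eq_of_result
      exact Or.inr (Or.inl ⟨_, _, hc, rfl, rfl⟩)
    | call₂ hc =>
      obtain ⟨rfl, rfl⟩ := hr.eq_of_fail
      exact Or.inr (Or.inr ⟨_, hc, rfl, rfl⟩)

theorem Run.call_result {r : ι} {G H : HostGraph V E} {tr : List (Event ι)}
    (h : Run env (.run (.call r) G) tr (.result H)) :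
    ∃ k, CallSucceeds (env r) G H k ∧ tr = [.call r k] := by
  obtain ⟨-, h'⟩ | ⟨H', k, hc, htr, h'⟩ | ⟨k, -, -, h'⟩ := h.call_cases <;> cases h'
  exact ⟨k, hc, htr⟩

theorem Run.call_fail {r : ι} {G : HostGraph V E} {tr : List (Event ι)}
    (h : Run env (.run (.call r) G) tr .fail) :
    ∃ k, CallFails (env r) G k ∧ tr = [.call r k] := by
  obtain ⟨-, h'⟩ | ⟨H', k, -, -, h'⟩ | ⟨k, hc, htr, -⟩ := h.call_cases
  · cases h'
  · cases h'
  · exact ⟨k, hc, htr⟩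

/-- This rules out that the inner loop over `forward` is left by `break`. -/
theorem Run.not_call_brk {r : ι} {G H : HostGraph V E} {tr : List (Event ι)} :
    ¬ Run env (.run (.call r) G) tr (.run .brk H) := by
  intro h
  obtain ⟨-, h⟩ | ⟨H', k, -, -, h⟩ | ⟨k, -, -, h⟩ := h.call_cases <;> cases h

theorem not_canDiverge_of_budget {I : Config ι V E → ℕ → Prop}
    (hstep : ∀ c n, I c n → ∀ tr c', Step env c tr c' → ∃ n' < n, I c' n')
    (henters : ∀ c n, I c n → ∀ c', Enters c c' → ∃ n' < n, I c' n')
    {P : Command ι} {G : HostGraph V E} {n : ℕ} (h : I (.run P G) n) : ¬ CanDiverge env P G := by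
  rintro ⟨f, h0, hf⟩
  have key : ∀ n i, ¬ I (f i) n := by
    intro n
    induction n using Nat.strong_induction_on with
    | _ n ih =>
      intro i hi
      rcases hf i with ⟨tr, hs⟩ | he
      · obtain ⟨n', hn', h'⟩ := hstep _ _ hi _ _ hs
        exact ih n' hn' _ h'
      · obtain ⟨n', hn', h'⟩ := henters _ _ hi _ he
        exact ih n' hn' _ h'
  exact key n 0 (h0 ▸ h)

theorem CallSucceeds.exists_cost {r : Rule} {G H : HostGraph V E} {k : ℕ}
    (h : CallSucceeds r G H k) :
    ∃ π : Layout G, k = (findMatch r π).2 + 2 * (r.n + r.m) := by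
  obtain ⟨g, π, k₀, h, -, rfl⟩ := h
  exact ⟨π, by rw [h]⟩

theorem CallFails.exists_cost {r : Rule} {G : HostGraph V E} {k : ℕ} (h : CallFails r G k) :
    ∃ π : Layout G, k = (findMatch r π).2 := by
  obtain ⟨-, π, h⟩ := h
  exact ⟨π, by rw [h]⟩

theorem CallSucceeds.exists_match {r : Rule} {G H : HostGraph V E} {k : ℕ}
    (h : CallSucceeds r G H k) : ∃ g : Match r G, H = g.result := by
  obtain ⟨g, π, k₀, -, rfl, -⟩ := h
  exact ⟨g, rfl⟩

end Execution

-- The potential of the node marks and the uniqueness of the root.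

section Potential

/-- The two sums over `β` differ only on the image of `g`; stated additively to avoid subtraction in
ℕ. -/
theorem sum_extend_add {α β γ : Type} [Fintype α] [Fintype β] {g : α → β}
    (hg : Function.Injective g) (w : γ → ℕ) (a : α → γ) (b : β → γ) :
    ∑ v, w (Function.extend g a b v) + ∑ i, w (b (g i)) = ∑ v, w (b v) + ∑ i, w (a i) := by
  classical
  have key : ∀ f : β → ℕ, ∑ v, f v =
      ∑ i, f (g i) + ∑ v ∈ (Finset.univ.map ⟨g, hg⟩)ᶜ, f v := fun f => by
    rw [← Finset.sum_add_sum_compl (Finset.univ.map ⟨g, hg⟩) f, Finset.sum_map]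
    rfl
  rw [key fun v => w (Function.extend g a b v), key fun v => w (b v)]
  have h₁ : ∑ i, w (Function.extend g a b (g i)) = ∑ i, w (a i) :=
    Finset.sum_congr rfl fun i _ => by rw [hg.extend_apply]
  have h₂ : ∑ v ∈ (Finset.univ.map ⟨g, hg⟩)ᶜ, w (Function.extend g a b v) =
      ∑ v ∈ (Finset.univ.map ⟨g, hg⟩)ᶜ, w (b v) :=
    Finset.sum_congr rfl fun v hv => by
      rw [Function.extend_apply']
      rintro ⟨i, rfl⟩
      simp at hv
  rw [h₁, h₂]
  omega

variable {V E : Type}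

/-- A grey node can be visited and left, a blue node can only be left. -/
def NodeMark.potential : NodeMark → ℕ
  | .grey => 2
  | .blue => 1
  | _ => 0

/-- How many applications of `forward` and `back` the marks of the nodes permit. -/
def HostGraph.potential [Fintype V] (G : HostGraph V E) : ℕ := ∑ v, (G.nodeMark v).potential

theorem HostGraph.potential_le [Fintype V] (G : HostGraph V E) : G.potential ≤ 2 * Nat.card V := by
  refine (Finset.sum_le_card_nsmul Finset.univ _ 2 fun v _ => ?_).trans ?_
  · cases G.nodeMark v <;> simp [NodeMark.potential]
  · simp [mul_comm]

/-- The change of potential depends on the marks in the rule alone. -/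
theorem Match.potential_result [Fintype V] {r : Rule} {G : HostGraph V E} (g : Match r G) :
    g.result.potential + ∑ i, (r.lhsNodeMark i).potential =
      G.potential + ∑ i, (r.rhsNodeMark i).potential := by
  have := sum_extend_add g.node_injective NodeMark.potential r.rhsNodeMark G.nodeMark
  simp only [g.nodeMark] at this
  exact this

/-- Graphs of node degree at most `d` with at most one root. -/
structure HostGraph.IsTraversal (d : ℕ) (G : HostGraph V E) : Prop where
  degree_le : ∀ v, G.degree v ≤ d
  root_unique : ∀ u v, G.isRoot u = true → G.isRoot v = true → u = v

/-- All old roots are matched and hence overwritten, so the roots of the result come from the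
right-hand side. The underlying graph, and with it every degree, is untouched. -/
theorem Match.isTraversal_result {d : ℕ} {r : Rule} {G : HostGraph V E} (g : Match r G)
    (hd : ∀ v, G.degree v ≤ d) (hG : ∀ v, G.isRoot v = true → v ∈ Set.range g.node)
    (hr : ∀ i j, r.rhsRoot i = true → r.rhsRoot j = true → i = j) : g.result.IsTraversal d := by
  have key : ∀ v, g.result.isRoot v = true → ∃ i, g.node i = v ∧ r.rhsRoot i = true := by
    intro v hv
    by_cases h : v ∈ Set.range g.node
    · obtain ⟨i, rfl⟩ := h
      have : g.result.isRoot (g.node i) = r.rhsRoot i := g.node_injective.extend_apply _ _ _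
      exact ⟨i, rfl, this ▸ hv⟩
    · have : g.result.isRoot v = G.isRoot v := Function.extend_apply' _ _ _ h
      exact absurd (hG v (this ▸ hv)) h
  refine ⟨hd, fun u v hu hv => ?_⟩
  obtain ⟨i, rfl, hi⟩ := key u hu
  obtain ⟨j, rfl, hj⟩ := key v hv
  rw [hr i j hi hj]

end Potential

-- Cost and effect of calls of the four rules.

namespace IsConnected

variable {V E : Type} {G H : HostGraph V E} {d k : ℕ}

/-- A bound on the number of basic operations of a call of a rule other than `check`. -/
def unitCost (d : ℕ) : ℕ := 20 + 18 * d

theorem forward_findMatch_cost_le [Finite E] (hG : G.IsTraversal d) (π : Layout G) :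
    (findMatch forward π).2 ≤ 8 + 18 * d :=
  search_root_edge_cost_le π _ _ _ hG.degree_le hG.root_unique

theorem back_findMatch_cost_le [Finite E] (hG : G.IsTraversal d) (π : Layout G) :
    (findMatch back π).2 ≤ 8 + 18 * d :=
  search_root_edge_cost_le π _ _ _ hG.degree_le hG.root_unique

theorem check_findMatch_cost_le [Finite V] (π : Layout G) :
    (findMatch check π).2 ≤ 1 + 5 * Nat.card V := by
  have := tryCandidates_cost_le (w := 1)
    (ok := fun v => nodeOk (r := check) G ⟨fun _ => none, fun _ => none⟩ 0 v)
    (next := fun v =>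
      search π (r := check) [] ⟨Function.update (fun _ => none) 0 (some v), fun _ => none⟩)
    (B := 0) (fun _ => le_rfl) π.nodes
  have hn := π.length_nodes_le
  change (findMatch check π).2 ≤ _ at this
  omega

/-- Although `init` runs through the node list, every node of an input graph fits, so the search
stops at the first one: a fetch, a test, a comparison and a flag. -/
theorem init_findMatch_cost_le (hG : G.IsInput) (π : Layout G) : (findMatch init π).2 ≤ 4 := by
  change (tryCandidates 1 (fun v => nodeOk (r := init) G ⟨fun _ => none, fun _ => none⟩ 0 v)
    (fun v => search π [] ⟨Function.update (fun _ => none) 0 (some v), fun _ => none⟩)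
    π.nodes).2 ≤ 4
  rcases π.nodes with _ | ⟨v, l⟩
  · simp [tryCandidates]
  · have hok : nodeOk (r := init) G ⟨fun _ => none, fun _ => none⟩ 0 v :=
      ⟨fun _ => by simp, hG.grey v, hG.unrooted v⟩
    simp only [tryCandidates, hok, if_true, search]
    omega

theorem forward_succeeds [Fintype V] [Finite E] (hG : G.IsTraversal d)
    (h : CallSucceeds (rules .forward) G H k) :
    H.IsTraversal d ∧ H.potential + 1 = G.potential ∧ k ≤ unitCost d := by
  obtain ⟨π, hk⟩ := h.exists_cost
  obtain ⟨g, rfl⟩ := h.exists_match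
  refine ⟨?_, ?_, ?_⟩
  · refine g.isTraversal_result hG.degree_le (fun v hv => ⟨(0 : Fin 2), ?_⟩) ?_
    · exact hG.root_unique _ _ (g.isRoot (0 : Fin 2)) hv
    · exact fun (i j : Fin 2) hi hj => by fin_cases i <;> fin_cases j <;> simp_all [rules]
  -- Blue and grey (1 + 2) become blue and blue (1 + 1).
  · have h : g.result.potential + ∑ i : Fin 2, (forward.lhsNodeMark i).potential =
      G.potential + ∑ i : Fin 2, (forward.rhsNodeMark i).potential := g.potential_result
    simp [NodeMark.potential] at h
    omega
  · have := forward_findMatch_cost_le hG π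
    change k = (findMatch forward π).2 + 6 at hk
    unfold unitCost
    omega

theorem back_succeeds [Fintype V] [Finite E] (hG : G.IsTraversal d)
    (h : CallSucceeds (rules .back) G H k) :
    H.IsTraversal d ∧ H.potential + 1 = G.potential ∧ k ≤ unitCost d := by
  obtain ⟨π, hk⟩ := h.exists_cost
  obtain ⟨g, rfl⟩ := h.exists_match
  refine ⟨?_, ?_, ?_⟩
  · refine g.isTraversal_result hG.degree_le (fun v hv => ⟨(1 : Fin 2), ?_⟩) ?_
    · exact hG.root_unique _ _ (g.isRoot (1 : Fin 2)) hv
    · exact fun (i j : Fin 2) hi hj => by fin_cases i <;> fin_cases j <;> simp_all [rules]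
  -- Blue and blue (1 + 1) become blue and unmarked (1 + 0).
  · have h : g.result.potential + ∑ i : Fin 2, (back.lhsNodeMark i).potential =
      G.potential + ∑ i : Fin 2, (back.rhsNodeMark i).potential := g.potential_result
    simp [NodeMark.potential] at h
    omega
  · have := back_findMatch_cost_le hG π
    change k = (findMatch back π).2 + 6 at hk
    unfold unitCost
    omega

theorem init_succeeds [Fintype V] (hG : InputOfDegreeLE d G)
    (h : CallSucceeds (rules .init) G H k) :
    H.IsTraversal d ∧ H.potential ≤ G.potential ∧ k ≤ unitCost d := by
  obtain ⟨π, hk⟩ := h.exists_cost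
  obtain ⟨g, rfl⟩ := h.exists_match
  refine ⟨?_, ?_, ?_⟩
  · refine g.isTraversal_result hG.2 (fun v hv => ?_) ?_
    · simp [hG.1.unrooted v] at hv
    · exact fun i j _ _ => Subsingleton.elim (α := Fin 1) i j
  · have h : g.result.potential + ∑ i : Fin 1, (init.lhsNodeMark i).potential =
      G.potential + ∑ i : Fin 1, (init.rhsNodeMark i).potential := g.potential_result
    simp [NodeMark.potential] at h
    omega
  · have := init_findMatch_cost_le hG.1 π
    change k = (findMatch init π).2 + 2 at hk
    unfold unitCost
    omega

theorem forward_fails [Finite E] (hG : G.IsTraversal d) (h : CallFails (rules .forward) G k) :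
    k ≤ unitCost d := by
  obtain ⟨π, rfl⟩ := h.exists_cost
  have := forward_findMatch_cost_le hG π
  change (findMatch forward π).2 ≤ _
  unfold unitCost
  omega

theorem back_fails [Finite E] (hG : G.IsTraversal d) (h : CallFails (rules .back) G k) :
    k ≤ unitCost d := by
  obtain ⟨π, rfl⟩ := h.exists_cost
  have := back_findMatch_cost_le hG π
  change (findMatch back π).2 ≤ _
  unfold unitCost
  omega

theorem init_fails (hG : G.IsInput) (h : CallFails (rules .init) G k) : k ≤ unitCost d := by
  obtain ⟨π, rfl⟩ := h.exists_cost
  have := init_findMatch_cost_le hG π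
  change (findMatch init π).2 ≤ _
  unfold unitCost
  omega

theorem check_succeeds [Finite V] (d : ℕ) (h : CallSucceeds (rules .check) G H k) :
    k ≤ unitCost d * (G.size + 1) := by
  obtain ⟨π, hk⟩ := h.exists_cost
  have := check_findMatch_cost_le π
  change k = (findMatch check π).2 + 2 at hk
  have h20 : 20 * (G.size + 1) ≤ unitCost d * (G.size + 1) :=
    Nat.mul_le_mul_right _ (Nat.le_add_right _ _)
  unfold HostGraph.size at *
  omega

theorem check_fails [Finite V] (d : ℕ) (h : CallFails (rules .check) G k) :
    k ≤ unitCost d * (G.size + 1) := by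
  obtain ⟨π, rfl⟩ := h.exists_cost
  have := check_findMatch_cost_le π
  change (findMatch check π).2 ≤ _
  have h20 : 20 * (G.size + 1) ≤ unitCost d * (G.size + 1) :=
    Nat.mul_le_mul_right _ (Nat.le_add_right _ _)
  unfold HostGraph.size at *
  omega

-- Weights of events and budgets of configurations.

/-- A call of `check` counts `M`, where `M - 1` is the size of the graph, and any other event one. -/
def eventWeight (M : ℕ) : Event RuleName → ℕ
  | .call .check _ => M
  | _ => 1

/-- The configurations in an execution of the body of the loop in `main`, with a budget that pays
for the rest of the execution of `main`. -/
inductive BodyBudget [Fintype V] (d M : ℕ) : Config RuleName V E → ℕ → Prop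
  | dfs {G : HostGraph V E} : G.IsTraversal d →
      BodyBudget d M (.run dfs G) (10 * G.potential + M + 27)
  | tryElse {G : HostGraph V E} : G.IsTraversal d →
      BodyBudget d M (.run (.tryElse (.call .back) .brk) G) (10 * G.potential + M + 25)
  | tryThenElse {G : HostGraph V E} : G.IsTraversal d →
      BodyBudget d M (.run (.tryThenElse (.call .back) .skip .brk) G) (10 * G.potential + M + 24)
  -- The constant rises from 24 to 30 because this point is reached by a successful `back`, which
  -- frees 10 units; they pay for the next round of the loop as well.
  | skip {G : HostGraph V E} : G.IsTraversal d →
      BodyBudget d M (.run .skip G) (10 * G.potential + M + 30)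
  -- After `break` no traversal follows, so the potential is dropped. There is no constructor for
  -- `fail`: the body never fails.
  | brk {G : HostGraph V E} : BodyBudget d M (.run .brk G) (M + 4)
  | result {G : HostGraph V E} : G.IsTraversal d →
      BodyBudget d M (.result G) (10 * G.potential + M + 29)

/-- The configurations in an execution of `main`, with a budget that pays for the rest of it. -/
inductive MainBudget [Fintype V] (d M : ℕ) : Config RuleName V E → ℕ → Prop
  | main {G : HostGraph V E} : InputOfDegreeLE d G →
      MainBudget d M (.run main G) (10 * G.potential + M + 31)
  | tryThenElse {G : HostGraph V E} : InputOfDegreeLE d G →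
      MainBudget d M (.run (.tryThenElse (.call .init) (.seq (.loop dfs) checkProc) .skip) G)
        (10 * G.potential + M + 30)
  -- The constant 28 lies between 29 at the end of the body and 27 at its start, so that both
  -- leaving and entering the body lower the budget.
  | loop {G : HostGraph V E} : G.IsTraversal d →
      MainBudget d M (.run (.seq (.loop IsConnected.dfs) checkProc) G) (10 * G.potential + M + 28)
  | checkProc {G : HostGraph V E} : MainBudget d M (.run checkProc G) (M + 3)
  | ifThenElse {G : HostGraph V E} :
      MainBudget d M (.run (.ifThenElse (.call .check) .failure .skip) G) (M + 2)
  | failure {G : HostGraph V E} : MainBudget d M (.run .failure G) 1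
  | skip {G : HostGraph V E} : MainBudget d M (.run .skip G) 1
  | result {G : HostGraph V E} : MainBudget d M (.result G) 0
  | fail : MainBudget d M .fail 0

variable {d M : ℕ} {c c' : Config RuleName V E} {tr : List (Event RuleName)} {n : ℕ}

theorem BodyBudget.step [Fintype V] [Finite E] (h : BodyBudget d M c n)
    (hs : Step rules c tr c') :
    ∃ n' < n, BodyBudget d M c' n' ∧ (tr.map (eventWeight M)).sum + n' ≤ n ∧
      ∀ e ∈ tr, e.cost ≤ unitCost d * eventWeight M e := by
  have hK : 1 ≤ unitCost d := by unfold unitCost; omega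
  cases h with
  | dfs hG =>
    cases hs with
    | seq₁ hs =>
      cases hs with
      | alap₁ hr =>
        obtain ⟨k, hc, rfl⟩ := hr.call_result
        obtain ⟨hH, hp, hk⟩ := forward_succeeds hG hc
        refine ⟨_, ?_, .dfs hH, ?_, ?_⟩
        · omega
        · simp [eventWeight]; omega
        · simp [eventWeight, Event.cost, hk, hK]
    | seq₂ hs =>
      cases hs with
      | alap₂ hr =>
        obtain ⟨k, hc, rfl⟩ := hr.call_fail
        have hk := forward_fails hG hc
        refine ⟨_, ?_, .tryElse hG, ?_, ?_⟩
        · omega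
        · simp [eventWeight]; omega
        · simp [eventWeight, Event.cost, hk, hK]
      | alap₃ hr => exact absurd hr Run.not_call_brk
    | seq₃ hs => cases hs
  | tryElse hG =>
    cases hs
    refine ⟨_, ?_, .tryThenElse hG, ?_, ?_⟩
    · omega
    · simp [eventWeight]; omega
    · simp [eventWeight, Event.cost, hK]
  | tryThenElse hG =>
    cases hs with
    | try₁ hr =>
      obtain ⟨k, hc, rfl⟩ := hr.call_result
      obtain ⟨hH, hp, hk⟩ := back_succeeds hG hc
      refine ⟨_, ?_, .skip hH, ?_, ?_⟩
      · omega
      · simp [eventWeight]; omega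
      · simp [eventWeight, Event.cost, hk, hK]
    | try₂ hr =>
      obtain ⟨k, hc, rfl⟩ := hr.call_fail
      have hk := back_fails hG hc
      refine ⟨_, ?_, .brk, ?_, ?_⟩
      · omega
      · simp [eventWeight]; omega
      · simp [eventWeight, Event.cost, hk, hK]
  | skip hG =>
    cases hs
    refine ⟨_, ?_, .result hG, ?_, ?_⟩
    · omega
    · simp [eventWeight]; omega
    · simp [eventWeight, Event.cost, hK]
  | brk => cases hs
  | result hG => cases hs

theorem BodyBudget.run [Fintype V] [Finite E] (h : BodyBudget d M c n) (hr : Run rules c tr c') :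
    ∃ n', BodyBudget d M c' n' ∧ (tr.map (eventWeight M)).sum + n' ≤ n ∧
      ∀ e ∈ tr, e.cost ≤ unitCost d * eventWeight M e :=
  Run.budget (fun _ _ h _ _ hs => h.step hs) hr n h

theorem MainBudget.step [Fintype V] [Finite E] (hM : M = Nat.card V + Nat.card E + 1)
    (h : MainBudget d M c n) (hs : Step rules c tr c') :
    ∃ n' < n, MainBudget d M c' n' ∧ (tr.map (eventWeight M)).sum + n' ≤ n ∧
      ∀ e ∈ tr, e.cost ≤ unitCost d * eventWeight M e := by
  have hK : 1 ≤ unitCost d := by unfold unitCost; omega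
  cases h with
  | main hG =>
    cases hs
    refine ⟨_, ?_, .tryThenElse hG, ?_, ?_⟩
    · omega
    · simp [eventWeight]; omega
    · simp [eventWeight, Event.cost, hK]
  | tryThenElse hG =>
    cases hs with
    | try₁ hr =>
      obtain ⟨k, hc, rfl⟩ := hr.call_result
      obtain ⟨hH, hp, hk⟩ := init_succeeds hG hc
      refine ⟨_, ?_, .loop hH, ?_, ?_⟩
      · omega
      · simp [eventWeight]; omega
      · simp [eventWeight, Event.cost, hk, hK]
    | try₂ hr =>
      obtain ⟨k, hc, rfl⟩ := hr.call_fail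
      have hk : k ≤ unitCost d := init_fails hG.1 hc
      refine ⟨_, ?_, .skip, ?_, ?_⟩
      · omega
      · simp [eventWeight]
      · simp [eventWeight, Event.cost, hk, hK]
  | loop hG =>
    cases hs with
    | seq₁ hs =>
      cases hs with
      | alap₁ hr =>
        -- The nested run is charged to the budget of the body; what is left at its end covers the
        -- control event and the next round.
        obtain ⟨n', h, hw, hc⟩ := (BodyBudget.dfs (M := M) hG).run hr
        cases h with
        | result hH =>
          refine ⟨_, ?_, .loop hH, ?_, ?_⟩
          · omega
          · simp [eventWeight]; omega
          · intro e he
            rcases List.mem_append.1 he with he | he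
            · exact hc e he
            · rw [List.mem_singleton.1 he]
              simpa [eventWeight, Event.cost] using hK
    | seq₂ hs =>
      cases hs with
      | alap₂ hr =>
        obtain ⟨n', h, -⟩ := (BodyBudget.dfs (M := M) hG).run hr
        -- The body has no failing configuration.
        cases h
      | alap₃ hr =>
        obtain ⟨n', h, hw, hc⟩ := (BodyBudget.dfs (M := M) hG).run hr
        cases h with
        | brk =>
          refine ⟨_, ?_, .checkProc, ?_, ?_⟩
          · omega
          · simp [eventWeight]; omega
          · intro e he
            rcases List.mem_append.1 he with he | he
            · exact hc e he
            · rw [List.mem_singleton.1 he]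
              simpa [eventWeight, Event.cost] using hK
    | seq₃ hs => cases hs
  | checkProc =>
    cases hs
    refine ⟨_, ?_, .ifThenElse, ?_, ?_⟩
    · omega
    · simp [eventWeight]; omega
    · simp [eventWeight, Event.cost, hK]
  | ifThenElse =>
    cases hs with
    | if₁ hr =>
      obtain ⟨k, hc, rfl⟩ := hr.call_result
      have hk : k ≤ unitCost d * M := hM ▸ check_succeeds d hc
      refine ⟨_, ?_, .failure, ?_, ?_⟩
      · omega
      · simp [eventWeight]
      · simp [eventWeight, Event.cost, hk, hK]
    | if₂ hr =>
      obtain ⟨k, hc, rfl⟩ := hr.call_fail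
      have hk : k ≤ unitCost d * M := hM ▸ check_fails d hc
      refine ⟨_, ?_, .skip, ?_, ?_⟩
      · omega
      · simp [eventWeight]
      · simp [eventWeight, Event.cost, hk, hK]
  | failure =>
    cases hs
    refine ⟨_, ?_, .fail, ?_, ?_⟩
    · omega
    · simp [eventWeight]
    · simp [eventWeight, Event.cost, hK]
  | skip =>
    cases hs
    refine ⟨_, ?_, .result, ?_, ?_⟩
    · omega
    · simp [eventWeight]
    · simp [eventWeight, Event.cost, hK]
  | result => cases hs
  | fail => cases hs

theorem MainBudget.run [Fintype V] [Finite E] (hM : M = Nat.card V + Nat.card E + 1)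
    (h : MainBudget d M c n) (hr : Run rules c tr c') :
    ∃ n', MainBudget d M c' n' ∧ (tr.map (eventWeight M)).sum + n' ≤ n ∧
      ∀ e ∈ tr, e.cost ≤ unitCost d * eventWeight M e :=
  Run.budget (fun _ _ h _ _ hs => h.step hM hs) hr n h

-- Progress: no execution gets stuck.

theorem exists_run_call [Finite V] [Finite E] (r : RuleName) (G : HostGraph V E) :
    (∃ tr H, Run rules (.run (.call r) G) tr (.result H)) ∨
      ∃ tr, Run rules (.run (.call r) G) tr .fail := by
  rcases exists_call r G with ⟨H, k, h⟩ | ⟨k, h⟩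
  · exact Or.inl ⟨_, H, Run.single (.call₁ h)⟩
  · exact Or.inr ⟨_, Run.single (.call₂ h)⟩

theorem BodyBudget.exists_step [Fintype V] [Finite E] (h : BodyBudget d M c n) :
    (∃ G, c = .result G) ∨ (∃ G, c = .run .brk G) ∨ ∃ tr c', Step rules c tr c' := by
  cases h with
  | @dfs G _ =>
    rcases exists_run_call .forward G with ⟨tr, H, h⟩ | ⟨tr, h⟩
    · exact Or.inr (Or.inr ⟨_, _, .seq₁ (.alap₁ h)⟩)
    · exact Or.inr (Or.inr ⟨_, _, .seq₂ (.alap₂ h)⟩)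
  | tryElse => exact Or.inr (Or.inr ⟨_, _, .try₄⟩)
  | @tryThenElse G _ =>
    rcases exists_run_call .back G with ⟨tr, H, h⟩ | ⟨tr, h⟩
    · exact Or.inr (Or.inr ⟨_, _, .try₁ h⟩)
    · exact Or.inr (Or.inr ⟨_, _, .try₂ h⟩)
  | skip => exact Or.inr (Or.inr ⟨_, _, .skip⟩)
  | brk => exact Or.inr (Or.inl ⟨_, rfl⟩)
  | result => exact Or.inl ⟨_, rfl⟩

/-- A transition of the outer loop presupposes a completed run of its body; strong induction on the
budget supplies one. -/
theorem BodyBudget.exists_run [Fintype V] [Finite E] (h : BodyBudget d M c n) :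
    (∃ tr G, Run rules c tr (.result G)) ∨ ∃ tr G, Run rules c tr (.run .brk G) := by
  induction n using Nat.strong_induction_on generalizing c with
  | _ n ih =>
    rcases h.exists_step with ⟨G, rfl⟩ | ⟨G, rfl⟩ | ⟨tr, c', hs⟩
    · exact Or.inl ⟨[], G, .refl _⟩
    · exact Or.inr ⟨[], G, .refl _⟩
    · obtain ⟨n', hn', h', -⟩ := h.step hs
      rcases ih n' hn' h' with ⟨tr', G, hr⟩ | ⟨tr', G, hr⟩
      · exact Or.inl ⟨_, G, .head hs hr⟩
      · exact Or.inr ⟨_, G, .head hs hr⟩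

theorem MainBudget.exists_step [Fintype V] [Finite E] {P : Command RuleName} {G : HostGraph V E}
    (h : MainBudget d M (.run P G) n) : ∃ tr c', Step rules (.run P G) tr c' := by
  cases h with
  | main => exact ⟨_, _, .try₃⟩
  | tryThenElse =>
    rcases exists_run_call .init G with ⟨tr, H, h⟩ | ⟨tr, h⟩
    · exact ⟨_, _, .try₁ h⟩
    · exact ⟨_, _, .try₂ h⟩
  | loop hG =>
    rcases (BodyBudget.dfs (M := M) hG).exists_run with ⟨tr, H, h⟩ | ⟨tr, H, h⟩
    · exact ⟨_, _, .seq₁ (.alap₁ h)⟩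
    · exact ⟨_, _, .seq₂ (.alap₃ h)⟩
  | checkProc => exact ⟨_, _, .if₃⟩
  | ifThenElse =>
    rcases exists_run_call .check G with ⟨tr, H, h⟩ | ⟨tr, h⟩
    · exact ⟨_, _, .if₁ h⟩
    · exact ⟨_, _, .if₂ h⟩
  | failure => exact ⟨_, _, .failure⟩
  | skip => exact ⟨_, _, .skip⟩

-- Termination, including nested executions.

/-- The configurations in an execution of `main` or in a nested execution, with a bound on the
number of transitions and nested executions to come. -/
inductive NestedBudget [Fintype V] (d M : ℕ) : Config RuleName V E → ℕ → Prop
  | main {c : Config RuleName V E} {n : ℕ} : MainBudget d M c n → NestedBudget d M c n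
  | body {c : Config RuleName V E} {n : ℕ} : BodyBudget d M c n → NestedBudget d M c n
  | call {r : RuleName} {G : HostGraph V E} : NestedBudget d M (.run (.call r) G) 1

theorem NestedBudget.step [Fintype V] [Finite E] (hM : M = Nat.card V + Nat.card E + 1)
    (h : NestedBudget d M c n) (hs : Step rules c tr c') : ∃ n' < n, NestedBudget d M c' n' := by
  cases h with
  | main h =>
    obtain ⟨n', hn', h', -⟩ := h.step hM hs
    exact ⟨n', hn', .main h'⟩
  | body h =>
    obtain ⟨n', hn', h', -⟩ := h.step hs
    exact ⟨n', hn', .body h'⟩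
  | call =>
    cases hs with
    | call₁ _ => exact ⟨0, one_pos, .main .result⟩
    | call₂ _ => exact ⟨0, one_pos, .main .fail⟩

theorem NestedBudget.enters [Fintype V] (h : NestedBudget d M c n) (he : Enters c c') :
    ∃ n' < n, NestedBudget d M c' n' := by
  cases h with
  | main h =>
    cases h with
    | main => cases he
    | tryThenElse =>
      cases he
      exact ⟨1, by omega, .call⟩
    | loop hG =>
      cases he with
      | seq he =>
        cases he
        exact ⟨_, by omega, .body (.dfs hG)⟩
    | checkProc => cases he
    | ifThenElse =>
      cases he
      exact ⟨1, by omega, .call⟩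
    | failure => cases he
    | skip => cases he
    | result => cases he
    | fail => cases he
  | body h =>
    cases h with
    | dfs =>
      cases he with
      | seq he =>
        cases he
        exact ⟨1, by omega, .call⟩
    | tryElse => cases he
    | tryThenElse =>
      cases he
      exact ⟨1, by omega, .call⟩
    | skip => cases he
    | brk => cases he
    | result => cases he
  | call => cases he

theorem main_terminates [Finite V] [Finite E] {G : HostGraph V E} (hG : InputOfDegreeLE d G) :
    Terminates rules main G := by
  have := Fintype.ofFinite V
  have hmain := MainBudget.main (M := Nat.card V + Nat.card E + 1) hG
  refine ⟨not_canDiverge_of_budget (fun c n h tr c' hs => h.step rfl hs)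
    (fun c n h c' he => h.enters he) (NestedBudget.main hmain), ?_⟩
  rintro ⟨tr, Q, H, hr, hstuck⟩
  obtain ⟨n', h', -⟩ := hmain.run rfl hr
  obtain ⟨tr', c', hs⟩ := h'.exists_step
  exact hstuck tr' c' hs

-- From weights to running time and numbers of calls.

theorem main_weight_le [Finite V] [Finite E] {G : HostGraph V E} (hG : InputOfDegreeLE d G)
    (hr : Run rules (.run main G) tr c) :
    (tr.map (eventWeight (G.size + 1))).sum ≤ 52 * (G.size + 1) ∧
      ∀ e ∈ tr, e.cost ≤ unitCost d * eventWeight (G.size + 1) e := by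
  have := Fintype.ofFinite V
  obtain ⟨n', -, hw, hc⟩ := (MainBudget.main (M := G.size + 1) hG).run rfl hr
  -- The initial budget is 10 · potential + (size + 1) + 31 with potential at most 2 · size, and 52
  -- = 20 + 1 + 31.
  refine ⟨hw.trans' (Nat.le_add_right _ _) |>.trans ?_, hc⟩
  have hp := G.potential_le
  have : Nat.card V ≤ G.size := Nat.le_add_right _ _
  omega

theorem time_le {K : ℕ} : ∀ {tr : List (Event RuleName)},
    (∀ e ∈ tr, e.cost ≤ K * eventWeight M e) → time tr ≤ K * (tr.map (eventWeight M)).sum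
  | [], _ => by simp [time]
  | e :: tr, h => by
    have ih : time tr ≤ _ := time_le fun e he => h e (List.mem_cons_of_mem _ he)
    have he := h e List.mem_cons_self
    simp only [time, List.map_cons, List.sum_cons, mul_add] at ih ⊢
    exact Nat.add_le_add he ih

/-- With `m = M` for `check`, a total weight of at most 52 · M leaves at most 52 calls of that rule,
a bound independent of the size. -/
theorem mul_numCalls_le {r : RuleName} {m : ℕ} (hm : ∀ k, m = eventWeight M (.call r k)) :
    ∀ tr : List (Event RuleName), m * numCalls r tr ≤ (tr.map (eventWeight M)).sum
  | [] => by simp [numCalls]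
  | e :: tr => by
    have ih : m * numCalls r tr ≤ _ := mul_numCalls_le hm tr
    simp only [numCalls, List.countP_cons, List.map_cons, List.sum_cons, mul_add] at ih ⊢
    by_cases he : Event.isCallOf r e = true
    · obtain ⟨k, rfl⟩ : ∃ k, e = .call r k := by
        cases e <;> simp_all [Event.isCallOf]
      have := (hm k).le
      simp only [he, if_true]
      omega
    · simp only [he]
      simp
      omega

end IsConnected
end GP2

theorem mainTheorem10 (d : ℕ) :
    ∃ c : ℕ,
      (∀ (V E : Type) [Finite V] [Finite E] (G : GP2.HostGraph V E), GP2.InputOfDegreeLE d G →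
        GP2.Terminates GP2.IsConnected.rules GP2.IsConnected.main G ∧
        ∀ (tr : List (GP2.Event GP2.IsConnected.RuleName))
          (X : GP2.Config GP2.IsConnected.RuleName V E),
          GP2.Run GP2.IsConnected.rules (.run GP2.IsConnected.main G) tr X →
            GP2.runningTime G tr ≤ c * (G.size + 1)) ∧
      (∃ s t : GP2.IsConnected.RuleName → ℕ → ℕ,
        GP2.IsBoundedBy GP2.IsConnected.rules GP2.IsConnected.main d s t ∧
        ∀ N : ℕ, GP2.complexityMeasure s t N ≤ c * (N + 1)) := by
  open GP2 GP2.IsConnected in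
  -- Each of the four rules contributes 52 · `unitCost d` · (N + 1) to the measure, and 208 = 4 ·
  -- 52; the 2 accounts for loading and writing the graph. For `check` the linear factor sits in the
  -- time per call, for the other rules in the number of calls.
  refine ⟨208 * unitCost d + 2, fun V E _ _ G hG => ⟨main_terminates hG, fun tr X hr => ?_⟩,
    fun r N => if r = .check then 52 else 52 * (N + 1),
    fun r N => unitCost d * eventWeight (N + 1) (.call r 0), ?_, fun N => ?_⟩
  · obtain ⟨hw, hc⟩ := main_weight_le hG hr
    have ht := (time_le hc).trans (Nat.mul_le_mul_left _ hw)
    unfold runningTime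
    nlinarith [Nat.zero_le (unitCost d * (G.size + 1))]
  · intro V E _ _ G hG tr X hr r
    obtain ⟨hw, hc⟩ := main_weight_le hG hr
    have hweight : ∀ k, eventWeight (G.size + 1) (.call r 0) =
        eventWeight (G.size + 1) (.call r k) :=
      fun k => by cases r <;> rfl
    refine ⟨?_, fun k hk => ?_⟩
    · have hn := (mul_numCalls_le hweight tr).trans hw
      by_cases hr : r = .check
      · subst hr
        dsimp only
        rw [if_pos rfl]
        rw [mul_comm 52] at hn
        exact Nat.le_of_mul_le_mul_left hn (Nat.succ_pos _)
      · dsimp only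
        rw [if_neg hr]
        cases r <;> simp_all [eventWeight]
    · dsimp only
      rw [hweight k]
      exact hc _ hk
  · have hsum : ∀ f : RuleName → ℕ, ∑ r, f r = f .init + f .check + f .forward + f .back := by
      intro f
      change ∑ r ∈ ({.init, .check, .forward, .back} : Finset RuleName), f r = _
      simp [add_assoc]
    rw [complexityMeasure, hsum]
    simp [eventWeight]
    nlinarith [Nat.zero_le (unitCost d * (N + 1))]
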